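/- Let $L$ be a finite set, let $I\subseteq L\times L$ be an irreflexive symmetric relation (independence) with complement $D=(L\times L)\setminus I$ (dependence), and let $(G_\alpha)_{\alpha\in L}$ be finitely generated non-trivial groups. Let $G$ be the graph product, i.e. the quotient of the free product $\ast_{\alpha\in L}G_\alpha$ by the relations $gh=hg$ for all $g\in G_\alpha$, $h\in G_\beta$ with $(\alpha,\beta)\in I$. Let $\Gamma$ be the disjoint union of the sets $\Gamma_\alpha=G_\alpha\setminus\{1\}$; a word over $\Gamma$ denotes the product of its letters in $G$. The dependence graph $D(w)$ of a word $w=a_1\cdots a_n\in\Gamma^*$, $a_i\in\Gamma_{\alpha_i}$, is the directed graph with vertices $1,\dots,n$, where $i$ is labeled by $a_i$, and with arcs $(i,j)$ for all $i<j$ with $(\alpha_i,\alpha_j)\in D$. Write $u\equiv v$ if $D(u)$ and $D(v)$ are isomorphic as node-labeled directed graphs. The Hasse diagram of $D(w)$ is obtained by removing each arc $(i,k)$ for which there is a vertex $j$ with arcs $(i,j)$ and $(j,k)$. The word $w$ is reduced if no arc $(i,j)$ of the Hasse diagram has $\alpha_i=\alpha_j$, and cyclically reduced if, moreover, there are no minimal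 vertex $i$ (no incoming arc) and maximal vertex $j$ (no outgoing arc) of $D(w)$ with $i\ne j$ and $\alpha_i=\alpha_j$. The alphabet of $w$ is $\mathrm{alph}(w)=\{\alpha_1,\dots,\alpha_n\}\subseteq L$, and $w$ is connected if $\mathrm{alph}(w)$ induces a connected subgraph of $(L,D)$. Words $u,v\in\Gamma^*$ are transposed if there are $r,s\in\Gamma^*$ with $u\equiv rs$ and $v\equiv sr$; let $\approx$ be the transitive closure of this relation. Proposition. Let $x,y\in\Gamma^*$ be cyclically reduced and connected words such that $\mathrm{alph}(x)=\mathrm{alph}(y)$ and $|\mathrm{alph}(x)|\ge 2$. Then $x$ and $y$ are conjugate in $G$ if and only if $x\approx y$. -/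

import Mathlib

namespace GraphProd

universe u v

variable {L : Type u}

/-- The defining relators of a graph product inside the free product of the node groups:
the commutators of `g : G α` and `h : G β` for independent nodes `α`, `β`.
The irreflexive symmetric independence relation is the adjacency relation of `I`. -/
def relators (I : SimpleGraph L) (G : L → Type v) [∀ α, Group (G α)] :
    Set (Monoid.CoprodI G) :=
  {w | ∃ (α β : L) (g : G α) (h : G β), I.Adj α β ∧
    w = Monoid.CoprodI.of g * Monoid.CoprodI.of h *
      (Monoid.CoprodI.of g)⁻¹ * (Monoid.CoprodI.of h)⁻¹}

/-- The graph product of the groups `G α`: the quotient of the free product by the relations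
`g h = h g` for `g : G α`, `h : G β` with `α`, `β` independent. -/
abbrev GraphProduct (I : SimpleGraph L) (G : L → Type v) [∀ α, Group (G α)] : Type (max u v) :=
  Monoid.CoprodI G ⧸ Subgroup.normalClosure (relators I G)

/-- The alphabet `Γ`: the disjoint union of the sets `Γ_α = G α \ {1}`. -/
structure Letter (G : L → Type v) [∀ α, Group (G α)] where
  /-- The node `α` with the letter in `Γ_α`. -/
  node : L
  /-- The underlying group element. -/
  val : G node
  /-- Letters are nontrivial. -/
  ne_one : val ≠ 1

/-- Words over `Γ`. -/
abbrev Word (G : L → Type v) [∀ α, Group (G α)] : Type (max u v) := List (Letter G)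

variable {G : L → Type v} [∀ α, Group (G α)]

/-- The element of the graph product that is denoted by a word over `Γ`. -/
def Word.toGroup (I : SimpleGraph L) (w : Word G) : GraphProduct I G :=
  (w.map fun a => ((Monoid.CoprodI.of a.val : Monoid.CoprodI G) : GraphProduct I G)).prod

/-- The arcs of the dependence graph `D(w)`. Its vertices are the positions of `w`, labelled by
the letters of `w`; the dependence relation on nodes is the complement of the independence
relation, so every node depends on itself. -/
def Arc (I : SimpleGraph L) (w : Word G) (i j : Fin w.length) : Prop :=
  i < j ∧ ¬ I.Adj (w.get i).node (w.get j).node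

/-- `u ≡ v`: the dependence graphs of `u` and `v` are isomorphic as node-labelled directed
graphs. -/
def DepIso (I : SimpleGraph L) (u v : Word G) : Prop :=
  ∃ σ : Fin u.length ≃ Fin v.length,
    (∀ i, v.get (σ i) = u.get i) ∧ ∀ i j, Arc I u i j ↔ Arc I v (σ i) (σ j)

/-- The arcs of the Hasse diagram of the dependence graph: arcs `(i, k)` for which there is no `j`
with arcs `(i, j)` and `(j, k)`. -/
def HasseArc (I : SimpleGraph L) (w : Word G) (i k : Fin w.length) : Prop :=
  Arc I w i k ∧ ¬ ∃ j, Arc I w i j ∧ Arc I w j k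

/-- A word is reduced if neighbours in the Hasse diagram of its dependence graph have labels from
different nodes. -/
def IsReduced (I : SimpleGraph L) (w : Word G) : Prop :=
  ∀ i j, HasseArc I w i j → (w.get i).node ≠ (w.get j).node

/-- Minimal vertices of the dependence graph. -/
def IsMinVertex (I : SimpleGraph L) (w : Word G) (i : Fin w.length) : Prop :=
  ∀ j, ¬ Arc I w j i

/-- Maximal vertices of the dependence graph. -/
def IsMaxVertex (I : SimpleGraph L) (w : Word G) (i : Fin w.length) : Prop :=
  ∀ j, ¬ Arc I w i j

/-- A reduced word is cyclically reduced if there are no minimal vertex `i` and maximal vertex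
`j ≠ i` of the dependence graph with labels from the same node. -/
def IsCyclicallyReduced (I : SimpleGraph L) (w : Word G) : Prop :=
  IsReduced I w ∧
    ∀ i j, IsMinVertex I w i → IsMaxVertex I w j → i ≠ j → (w.get i).node ≠ (w.get j).node

/-- The alphabet of a word: the set of nodes `α` such that some letter of `w` is in `Γ_α`. -/
def al (w : Word G) : Set L :=
  {α | ∃ a ∈ w, a.node = α}

/-- A word is connected if its alphabet induces a connected subgraph of the graph `(L, D)` of
the dependence relation (loops are irrelevant for this). -/
def IsConnected (I : SimpleGraph L) (w : Word G) : Prop :=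
  (Iᶜ.induce (al w)).Connected

/-- The words `u` and `v` are transposed: `u ≡ rs` and `v ≡ sr` for some words `r`, `s`. -/
def Transposed (I : SimpleGraph L) (u v : Word G) : Prop :=
  ∃ r s : Word G, DepIso I u (r ++ s) ∧ DepIso I v (s ++ r)

/-- The relation `≈`: the transitive closure of transposition. -/
def TranspositionEquiv (I : SimpleGraph L) : Word G → Word G → Prop :=
  Relation.TransGen (Transposed I)

end GraphProd

/-!
Reduced words up to `≡` are normal forms for the elements of the graph product: the graph product
acts on their classes, where `g : G α` is multiplied to the first letter in `G α`, and the element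
denoted by a reduced word sends the class of the empty word to the class of that word.

Let a reduced word `w` conjugate `x` to `y`, so that `wx = yw` and `wx⁻¹ = y⁻¹w`. If `w` has a first
letter in common with `y` or `y⁻¹`, or `w⁻¹` has one in common with `x` or `x⁻¹`, then a
transposition of `y` or `x` lets `w` become shorter. Otherwise no letter cancels in these four
products. If the first letter of `w`, from `G α` say, depends on some letter of `y`, then comparing
the first letters of both sides shows that `y` and `y⁻¹` both begin with a letter from `G α`, which
contradicts the cyclic reducedness of `y`: by connectedness, no letter of `y` is independent of all
the others, so these are two letters. Hence the first letter of `w` commutes with `y` and can be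
dropped from `w`.
-/

namespace GraphProd

universe u v

variable {L : Type u} {G : L → Type v} [∀ α, Group (G α)] {I : SimpleGraph L}

/-! ### Traces -/

/-- Trace equivalence: words that differ by swaps of adjacent independent letters. It is the
inductive counterpart of `DepIso`, and its classes are the traces over `Γ`. -/
inductive TraceEq (I : SimpleGraph L) : Word G → Word G → Prop
  | nil : TraceEq I [] []
  | cons (a : Letter G) {u v : Word G} : TraceEq I u v → TraceEq I (a :: u) (a :: v)
  | swap (a b : Letter G) (u : Word G) :
      I.Adj a.node b.node → TraceEq I (a :: b :: u) (b :: a :: u)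
  | trans {u v w : Word G} : TraceEq I u v → TraceEq I v w → TraceEq I u w

namespace TraceEq

attribute [trans] TraceEq.trans

variable {u v : Word G}

@[refl]
theorem refl : ∀ u : Word G, TraceEq I u u
  | [] => nil
  | a :: u => cons a (refl u)

protected theorem rfl : TraceEq I u u := refl u

@[symm]
theorem symm (h : TraceEq I u v) : TraceEq I v u := by
  induction h with
  | nil => exact nil
  | cons a _ ih => exact cons a ih
  | swap a b u hab => exact swap b a u hab.symm
  | trans _ _ ih₁ ih₂ => exact ih₂.trans ih₁

theorem perm (h : TraceEq I u v) : u.Perm v := by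
  induction h with
  | nil => exact .nil
  | cons a _ ih => exact .cons a ih
  | swap a b u => exact .swap b a u
  | trans _ _ ih₁ ih₂ => exact ih₁.trans ih₂

theorem append_left (w : Word G) (h : TraceEq I u v) : TraceEq I (w ++ u) (w ++ v) := by
  induction w with
  | nil => exact h
  | cons a w ih => exact cons a ih

theorem append_right (w : Word G) (h : TraceEq I u v) : TraceEq I (u ++ w) (v ++ w) := by
  induction h with
  | nil => exact .rfl
  | cons a _ ih => exact cons a ih
  | swap a b u hab => exact swap a b _ hab
  | trans _ _ ih₁ ih₂ => exact ih₁.trans ih₂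

end TraceEq

/-- The setoid of trace equivalence. -/
def traceSetoid (I : SimpleGraph L) : Setoid (Word G) :=
  ⟨TraceEq I, .refl, .symm, .trans⟩

section DependenceGraph

variable {a : Letter G} {w : Word G}

theorem arc_cons_succ_succ {i j : Fin w.length} :
    Arc I (a :: w) i.succ j.succ ↔ Arc I w i j :=
  and_congr Fin.succ_lt_succ_iff Iff.rfl

theorem arc_cons_zero_succ {j : Fin w.length} :
    Arc I (a :: w) (0 : Fin (w.length + 1)) j.succ ↔ ¬ I.Adj a.node (w.get j).node :=
  and_iff_right (Fin.succ_pos j)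

theorem not_arc_cons_zero (i : Fin (w.length + 1)) : ¬ Arc I (a :: w) i (0 : Fin (w.length + 1)) :=
  fun h => Fin.not_lt_zero i h.1

theorem swap_zero_one_lt_swap_zero_one {n : ℕ} {i j : Fin (n + 2)} (hij : i < j)
    (h : ¬ (i = 0 ∧ j = 1)) : Equiv.swap 0 1 i < Equiv.swap 0 1 j := by
  simp only [Equiv.swap_apply_def, Fin.ext_iff, Fin.lt_def, apply_ite Fin.val, Fin.val_zero,
    Fin.val_one] at *
  split_ifs <;> omega

namespace DepIso

variable {u v w : Word G}

theorem refl (u : Word G) : DepIso I u u :=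
  ⟨Equiv.refl _, fun _ => rfl, fun _ _ => Iff.rfl⟩

theorem trans (h₁ : DepIso I u v) (h₂ : DepIso I v w) : DepIso I u w := by
  obtain ⟨σ, hσ, hσ'⟩ := h₁
  obtain ⟨τ, hτ, hτ'⟩ := h₂
  exact ⟨σ.trans τ, fun i => (hτ _).trans (hσ i), fun i j => (hσ' i j).trans (hτ' _ _)⟩

theorem of_monotone (σ : Fin u.length ≃ Fin v.length) (hget : ∀ i, v.get (σ i) = u.get i)
    (hmono : ∀ i j, Arc I u i j → σ i < σ j) : DepIso I u v := by
  refine ⟨σ, hget, fun i j => ⟨fun h => ⟨hmono i j h, ?_⟩, fun ⟨hlt, hdep⟩ => ?_⟩⟩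
  · rw [hget, hget]
    exact h.2
  · rw [hget, hget] at hdep
    refine ⟨lt_of_not_ge fun hji => ?_, hdep⟩
    obtain rfl | hji := hji.eq_or_lt
    · exact lt_irrefl _ hlt
    · exact hlt.asymm (hmono j i ⟨hji, fun hadj => hdep hadj.symm⟩)

theorem cons (a : Letter G) (h : DepIso I u v) : DepIso I (a :: u) (a :: v) := by
  obtain ⟨σ, hσ, hσ'⟩ := h
  let τ : Fin (u.length + 1) ≃ Fin (v.length + 1) :=
    (finSuccEquiv u.length).trans ((Equiv.optionCongr σ).trans (finSuccEquiv v.length).symm)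
  have τ_zero : τ 0 = 0 := by simp [τ]
  have τ_succ (i) : τ (Fin.succ i) = (σ i).succ := by simp [τ]
  refine of_monotone τ (Fin.forall_fin_succ.2 ⟨?_, fun i => ?_⟩)
    (Fin.forall_fin_succ.2 ⟨?_, fun i => ?_⟩)
  · rw [τ_zero]; rfl
  · rw [τ_succ]; exact hσ i
  · refine Fin.forall_fin_succ.2 ⟨fun h => absurd h (not_arc_cons_zero _), fun j _ => ?_⟩
    rw [τ_zero, τ_succ]
    exact Fin.succ_pos _
  · refine Fin.forall_fin_succ.2 ⟨fun h => absurd h (not_arc_cons_zero _), fun j h => ?_⟩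
    rw [τ_succ, τ_succ]
    exact Fin.succ_lt_succ_iff.2 ((hσ' i j).1 (arc_cons_succ_succ.1 h)).1

theorem swap (a b : Letter G) (u : Word G) (hab : I.Adj a.node b.node) :
    DepIso I (a :: b :: u) (b :: a :: u) := by
  let τ : Fin (u.length + 2) ≃ Fin (u.length + 2) := Equiv.swap 0 1
  have τ_zero : τ 0 = 1 := Equiv.swap_apply_left 0 1
  have τ_one : τ 1 = 0 := Equiv.swap_apply_right 0 1
  have τ_succ (i : Fin u.length) : τ i.succ.succ = i.succ.succ :=
    Equiv.swap_apply_of_ne_of_ne (Fin.succ_ne_zero _) (Fin.succ_succ_ne_one i)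
  refine of_monotone τ ?_ ?_
  · refine Fin.forall_fin_succ.2 ⟨?_, Fin.forall_fin_succ.2 ⟨?_, fun i => ?_⟩⟩
    · rw [τ_zero]; rfl
    · exact congrArg _ τ_one
    · rw [τ_succ]; rfl
  · intro i j ⟨hij, hdep⟩
    refine swap_zero_one_lt_swap_zero_one hij ?_
    rintro ⟨rfl, rfl⟩
    exact hdep hab

end DepIso

theorem TraceEq.depIso {u v : Word G} (h : TraceEq I u v) : DepIso I u v := by
  induction h with
  | nil => exact .refl []
  | cons a _ ih => exact ih.cons a
  | swap a b u hab => exact .swap a b u hab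
  | trans _ _ ih₁ ih₂ => exact ih₁.trans ih₂

namespace TraceEq

theorem ofFn_move_front {n : ℕ} (g : Fin (n + 1) → Letter G) (k : Fin (n + 1))
    (hk : ∀ m < k, I.Adj (g m).node (g k).node) :
    TraceEq I (List.ofFn g) (g k :: List.ofFn (k.removeNth g)) := by
  induction n with
  | zero =>
    obtain rfl := Fin.fin_one_eq_zero k
    simpa [Fin.removeNth] using TraceEq.rfl
  | succ n ih =>
    induction k using Fin.cases with
    | zero => simpa [List.ofFn_succ, Fin.removeNth, Fin.tail] using TraceEq.rfl
    | succ k =>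
      have hmove := ih (Fin.tail g) k fun m hm => hk m.succ (Fin.succ_lt_succ_iff.2 hm)
      have hswap := swap (g 0) (g k.succ) (List.ofFn (k.removeNth (Fin.tail g))) (hk 0 k.succ_pos)
      have hremove : List.ofFn (k.succ.removeNth g) =
          g 0 :: List.ofFn (k.removeNth (Fin.tail g)) := by
        simp [List.ofFn_succ, Fin.removeNth_apply, Fin.tail_def, funext_iff]
      rw [List.ofFn_succ, hremove]
      exact (hmove.cons (g 0)).trans hswap

theorem ofFn_of_injective {n : ℕ} (f g : Fin n → Letter G) (σ : Fin n → Fin n)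
    (hσ : σ.Injective) (hget : ∀ i, g (σ i) = f i)
    (hmono : ∀ i j, i < j → ¬ I.Adj (f i).node (f j).node → σ i < σ j) :
    TraceEq I (List.ofFn f) (List.ofFn g) := by
  induction n with
  | zero => simpa using TraceEq.rfl
  | succ n ih =>
    have hmove : TraceEq I (List.ofFn g) (g (σ 0) :: List.ofFn ((σ 0).removeNth g)) := by
      refine ofFn_move_front g (σ 0) fun m hm => ?_
      obtain ⟨i, rfl⟩ := Finite.surjective_of_injective hσ m
      have hi : 0 < i := Fin.pos_iff_ne_zero.2 fun h => hm.ne (congrArg σ h)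
      by_contra hadj
      rw [hget, hget] at hadj
      exact hm.asymm (hmono 0 i hi fun h => hadj h.symm)
    have hne (i : Fin n) : σ i.succ ≠ σ 0 := hσ.ne i.succ_ne_zero
    choose τ hτ using fun i => Fin.exists_succAbove_eq (hne i)
    have hrest : TraceEq I (List.ofFn (Fin.tail f)) (List.ofFn ((σ 0).removeNth g)) := by
      refine ih _ _ τ (fun i j hij => ?_) (fun i => ?_) fun i j hij hadj => ?_
      · refine Fin.succ_injective _ (hσ ?_)
        rw [← hτ, ← hτ, hij]
      · rw [Fin.removeNth, hτ, hget, Fin.tail]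
      · rw [← Fin.succAbove_lt_succAbove_iff (p := σ 0), hτ, hτ]
        exact hmono _ _ (Fin.succ_lt_succ_iff.2 hij) hadj
    rw [List.ofFn_succ, ← hget]
    exact (hrest.cons _).trans hmove.symm

end TraceEq

theorem DepIso.traceEq {u v : Word G} (h : DepIso I u v) : TraceEq I u v := by
  obtain ⟨σ, hget, hσ⟩ := h
  have of_equiv {n m : ℕ} (f : Fin n → Letter G) (g : Fin m → Letter G) (σ : Fin n ≃ Fin m)
      (hget : ∀ i, g (σ i) = f i)
      (hmono : ∀ i j, i < j → ¬ I.Adj (f i).node (f j).node → σ i < σ j) :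
      TraceEq I (List.ofFn f) (List.ofFn g) := by
    obtain rfl : n = m := by simpa using Fintype.card_congr σ
    exact .ofFn_of_injective f g σ σ.injective hget hmono
  simpa only [List.ofFn_get] using
    of_equiv u.get v.get σ hget fun i j hij hdep => ((hσ i j).1 ⟨hij, hdep⟩).1

end DependenceGraph

/-! ### The graph product -/

namespace GraphProduct

/-- The canonical homomorphism of a node group into the graph product. -/
def of (I : SimpleGraph L) (α : L) : G α →* GraphProduct I G :=
  (QuotientGroup.mk' _).comp Monoid.CoprodI.of

theorem commute_of {α β : L} (h : I.Adj α β) (g : G α) (k : G β) :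
    Commute (of I α g) (of I β k) := by
  have hrel : of I α g * of I β k * (of I α g)⁻¹ * (of I β k)⁻¹ = 1 :=
    (QuotientGroup.eq_one_iff _).2 (Subgroup.subset_normalClosure ⟨α, β, g, k, h, rfl⟩)
  rwa [mul_inv_eq_one, mul_inv_eq_iff_eq_mul] at hrel

/-- The universal property of the graph product: homomorphisms of the node groups with commuting
images for independent nodes extend to the graph product. -/
def lift {M : Type*} [Monoid M] (f : ∀ α, G α →* M)
    (hf : ∀ ⦃α β⦄, I.Adj α β → ∀ g k, Commute (f α g) (f β k)) : GraphProduct I G →* M :=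
  QuotientGroup.lift _ (Monoid.CoprodI.lift f) <| Subgroup.normalClosure_le_normal <| by
    rintro _ ⟨α, β, g, k, h, rfl⟩
    have hcancel (α : L) (g : G α) : f α g * f α g⁻¹ = 1 := by
      rw [← map_mul, mul_inv_cancel, map_one]
    simp only [SetLike.mem_coe, MonoidHom.mem_ker, ← map_inv, map_mul, Monoid.CoprodI.lift_of]
    rw [(hf h g k).eq, mul_assoc (f β k), hcancel, mul_one, hcancel]

theorem lift_of {M : Type*} [Monoid M] (f : ∀ α, G α →* M)
    (hf : ∀ ⦃α β⦄, I.Adj α β → ∀ g k, Commute (f α g) (f β k)) {α : L} (g : G α) :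
    lift f hf (of I α g) = f α g :=
  Monoid.CoprodI.lift_of f g

end GraphProduct

/-- All letters of `w` are independent of the node `α`. -/
def IsIndep (I : SimpleGraph L) (α : L) (w : Word G) : Prop := ∀ a ∈ w, I.Adj α a.node

theorem isIndep_cons {α : L} {a : Letter G} {w : Word G} :
    IsIndep I α (a :: w) ↔ I.Adj α a.node ∧ IsIndep I α w :=
  List.forall_mem_cons

namespace Word

theorem toGroup_nil : toGroup I ([] : Word G) = 1 := rfl

theorem toGroup_cons (a : Letter G) (w : Word G) :
    toGroup I (a :: w) = GraphProduct.of I a.node a.val * toGroup I w := rfl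

theorem toGroup_append (u v : Word G) : toGroup I (u ++ v) = toGroup I u * toGroup I v := by
  simp [toGroup]

theorem toGroup_singleton (a : Letter G) :
    toGroup I [a] = GraphProduct.of I a.node a.val :=
  mul_one _

theorem toGroup_surjective : (toGroup I : Word G → GraphProduct I G).Surjective := by
  intro g
  induction g using QuotientGroup.induction_on with
  | H g =>
    induction g using Monoid.CoprodI.induction_on with
    | one => exact ⟨[], rfl⟩
    | of α g =>
      by_cases hg : g = 1
      · exact ⟨[], by rw [hg, map_one]; rfl⟩
      · exact ⟨[⟨α, g, hg⟩], toGroup_singleton _⟩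
    | mul g k ihg ihk =>
      obtain ⟨u, hu⟩ := ihg
      obtain ⟨v, hv⟩ := ihk
      exact ⟨u ++ v, by rw [toGroup_append, hu, hv, QuotientGroup.mk_mul]⟩

end Word

theorem TraceEq.toGroup_eq {u v : Word G} (h : TraceEq I u v) : u.toGroup I = v.toGroup I := by
  induction h with
  | nil => rfl
  | cons a _ ih => rw [Word.toGroup_cons, Word.toGroup_cons, ih]
  | swap a b u hab =>
    simp only [Word.toGroup_cons]
    exact (GraphProduct.commute_of hab _ _).left_comm _
  | trans _ _ ih₁ ih₂ => exact ih₁.trans ih₂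

theorem IsIndep.commute_toGroup {α : L} {w : Word G} (h : IsIndep I α w) (g : G α) :
    Commute (GraphProduct.of I α g) (w.toGroup I) := by
  induction w with
  | nil => exact Commute.one_right _
  | cons a w ih =>
    rw [isIndep_cons] at h
    exact (GraphProduct.commute_of h.1 g a.val).mul_right (ih h.2)

instance : InvolutiveInv (Letter G) where
  inv a := ⟨a.node, a.val⁻¹, inv_ne_one.2 a.ne_one⟩
  inv_inv a := by simp only [inv_inv]

theorem Letter.node_inv (a : Letter G) : a⁻¹.node = a.node := rfl

namespace Word

/-- The formal inverse of a word. -/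
def inv (w : Word G) : Word G := (w.map (·⁻¹)).reverse

theorem inv_cons (a : Letter G) (w : Word G) : inv (a :: w) = inv w ++ [a⁻¹] := by simp [inv]

theorem inv_append (u v : Word G) : inv (u ++ v) = inv v ++ inv u := by simp [inv]

theorem inv_concat (w : Word G) (a : Letter G) : inv (w ++ [a]) = a⁻¹ :: inv w := by simp [inv]

theorem inv_inv (w : Word G) : inv (inv w) = w := by simp [inv]

theorem length_inv (w : Word G) : (inv w).length = w.length := by simp [inv]

theorem toGroup_inv (w : Word G) : toGroup I (inv w) = (toGroup I w)⁻¹ := by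
  induction w with
  | nil => exact inv_one.symm
  | cons a w ih =>
    rw [inv_cons, toGroup_append, ih, toGroup_singleton, toGroup_cons, mul_inv_rev, ← map_inv]
    rfl

end Word

theorem isIndep_inv {α : L} {w : Word G} : IsIndep I α w.inv ↔ IsIndep I α w := by
  simp only [IsIndep, Word.inv, List.mem_reverse, List.forall_mem_map, Letter.node_inv]

theorem TraceEq.inv {u v : Word G} (h : TraceEq I u v) : TraceEq I u.inv v.inv := by
  induction h with
  | nil => exact .nil
  | cons a _ ih => simpa only [Word.inv_cons] using ih.append_right _
  | swap a b u hab =>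
    simpa [Word.inv_cons] using
      (TraceEq.swap b⁻¹ a⁻¹ [] hab.symm).append_left u.inv
  | trans _ _ ih₁ ih₂ => exact ih₁.trans ih₂

/-! ### First letters of traces -/

open Classical in
/-- The first letter in `G α` of the trace of `w`, read as an element of `G α`; it is `1` if the
trace does not begin with a letter of `G α`. -/
noncomputable def headAt (I : SimpleGraph L) (α : L) : Word G → G α
  | [] => 1
  | a :: w => if h : a.node = α then h ▸ a.val else if I.Adj α a.node then headAt I α w else 1

open Classical in
/-- What remains of `w` when the first letter `headAt I α w` of its trace is removed. -/
noncomputable def tailAt (I : SimpleGraph L) (α : L) : Word G → Word G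
  | [] => []
  | a :: w => if a.node = α then w else if I.Adj α a.node then a :: tailAt I α w else a :: w

open Classical in
/-- The word of length at most one that denotes `g : G α`. -/
noncomputable def single (α : L) (g : G α) : Word G := if h : g = 1 then [] else [⟨α, g, h⟩]

theorem eq_or_adj_or_compl_adj (I : SimpleGraph L) (α β : L) :
    α = β ∨ I.Adj α β ∨ Iᶜ.Adj α β := by
  rw [SimpleGraph.compl_adj]
  tauto

section Head

variable {α β : L} {a : Letter G} {u v w : Word G}

theorem single_one : single α (1 : G α) = [] := dif_pos rfl

theorem single_of_ne {g : G α} (hg : g ≠ 1) : single α g = [⟨α, g, hg⟩] := dif_neg hg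

theorem single_val (a : Letter G) : single a.node a.val = [a] := single_of_ne a.ne_one

theorem headAt_nil : headAt I α ([] : Word G) = 1 := rfl

theorem tailAt_nil : tailAt I α ([] : Word G) = [] := rfl

theorem headAt_cons_self (a : Letter G) (w : Word G) : headAt I a.node (a :: w) = a.val := by
  simp [headAt]

theorem tailAt_cons_self (a : Letter G) (w : Word G) : tailAt I a.node (a :: w) = w := by
  simp [tailAt]

theorem headAt_cons_of_adj (h : I.Adj α a.node) (w : Word G) :
    headAt I α (a :: w) = headAt I α w := by
  simp [headAt, h, h.ne']

theorem tailAt_cons_of_adj (h : I.Adj α a.node) (w : Word G) :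
    tailAt I α (a :: w) = a :: tailAt I α w := by
  simp [tailAt, h, h.ne']

theorem headAt_cons_of_compl_adj (h : Iᶜ.Adj α a.node) (w : Word G) :
    headAt I α (a :: w) = 1 := by
  rw [SimpleGraph.compl_adj] at h
  simp [headAt, h.1.symm, h.2]

theorem tailAt_cons_of_compl_adj (h : Iᶜ.Adj α a.node) (w : Word G) :
    tailAt I α (a :: w) = a :: w := by
  rw [SimpleGraph.compl_adj] at h
  simp [tailAt, h.1.symm, h.2]

theorem headAt_append_of_isIndep (h : IsIndep I α u) (v : Word G) :
    headAt I α (u ++ v) = headAt I α v := by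
  induction u with
  | nil => rfl
  | cons a u ih =>
    rw [isIndep_cons] at h
    rw [List.cons_append, headAt_cons_of_adj h.1, ih h.2]

theorem headAt_append_of_not_isIndep (h : ¬ IsIndep I α u) (v : Word G) :
    headAt I α (u ++ v) = headAt I α u := by
  induction u with
  | nil => exact absurd (by simp [IsIndep]) h
  | cons a u ih =>
    rw [isIndep_cons, not_and] at h
    rw [List.cons_append]
    obtain rfl | hadj | hadj := eq_or_adj_or_compl_adj I α a.node
    · rw [headAt_cons_self, headAt_cons_self]
    · rw [headAt_cons_of_adj hadj, headAt_cons_of_adj hadj, ih (h hadj)]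
    · rw [headAt_cons_of_compl_adj hadj, headAt_cons_of_compl_adj hadj]

theorem headAt_of_isIndep (h : IsIndep I α u) : headAt I α u = 1 := by
  simpa [headAt_nil] using headAt_append_of_isIndep h []

theorem headAt_append_of_ne_one (h : headAt I α u ≠ 1) (v : Word G) :
    headAt I α (u ++ v) = headAt I α u :=
  headAt_append_of_not_isIndep (fun hu => h (headAt_of_isIndep hu)) v

theorem headAt_concat_of_adj (w : Word G) (h : I.Adj α a.node) :
    headAt I α (w ++ [a]) = headAt I α w := by
  by_cases hw : IsIndep I α w
  · rw [headAt_append_of_isIndep hw, headAt_of_isIndep hw, headAt_cons_of_adj h, headAt_nil]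
  · exact headAt_append_of_not_isIndep hw [a]

theorem headAt_singleton_ne_one_iff : headAt I α [a] ≠ 1 ↔ a.node = α := by
  obtain rfl | hadj | hadj := eq_or_adj_or_compl_adj I α a.node
  · simpa [headAt_cons_self] using a.ne_one
  · simpa [headAt_cons_of_adj hadj, headAt_nil] using hadj.ne'
  · simpa [headAt_cons_of_compl_adj hadj] using hadj.ne'

theorem tailAt_eq_self (h : headAt I α w = 1) : tailAt I α w = w := by
  induction w with
  | nil => rfl
  | cons a w ih =>
    obtain rfl | hadj | hadj := eq_or_adj_or_compl_adj I α a.node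
    · rw [headAt_cons_self] at h
      exact absurd h a.ne_one
    · rw [headAt_cons_of_adj hadj] at h
      rw [tailAt_cons_of_adj hadj, ih h]
    · exact tailAt_cons_of_compl_adj hadj w

theorem headAt_tailAt_of_adj (h : I.Adj α β) (w : Word G) :
    headAt I α (tailAt I β w) = headAt I α w := by
  induction w with
  | nil => rfl
  | cons a w ih =>
    obtain rfl | hβ | hβ := eq_or_adj_or_compl_adj I β a.node
    · rw [tailAt_cons_self, headAt_cons_of_adj h]
    · rw [tailAt_cons_of_adj hβ]
      obtain rfl | hα | hα := eq_or_adj_or_compl_adj I α a.node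
      · rw [headAt_cons_self, headAt_cons_self]
      · rw [headAt_cons_of_adj hα, headAt_cons_of_adj hα, ih]
      · rw [headAt_cons_of_compl_adj hα, headAt_cons_of_compl_adj hα]
    · rw [tailAt_cons_of_compl_adj hβ]

theorem tailAt_comm (h : I.Adj α β) (w : Word G) :
    tailAt I α (tailAt I β w) = tailAt I β (tailAt I α w) := by
  induction w with
  | nil => rfl
  | cons a w ih =>
    obtain rfl | hα | hα := eq_or_adj_or_compl_adj I α a.node
    · rw [tailAt_cons_self, tailAt_cons_of_adj h.symm, tailAt_cons_self]
    all_goals obtain rfl | hβ | hβ := eq_or_adj_or_compl_adj I β a.node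
    · rw [tailAt_cons_self, tailAt_cons_of_adj h, tailAt_cons_self]
    all_goals simp only [tailAt_cons_of_adj, tailAt_cons_of_compl_adj, tailAt_cons_self, *]

theorem headAt_single_append (g : G α) (h : headAt I α w = 1) :
    headAt I α (single α g ++ w) = g := by
  by_cases hg : g = 1
  · rwa [hg, single_one]
  · rw [single_of_ne hg]
    exact headAt_cons_self ⟨α, g, hg⟩ w

theorem tailAt_single_append (g : G α) (h : headAt I α w = 1) :
    tailAt I α (single α g ++ w) = w := by
  by_cases hg : g = 1
  · rw [hg, single_one]
    exact tailAt_eq_self h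
  · rw [single_of_ne hg]
    exact tailAt_cons_self ⟨α, g, hg⟩ w

theorem headAt_single_append_of_adj (h : I.Adj α β) (g : G β) (w : Word G) :
    headAt I α (single β g ++ w) = headAt I α w := by
  by_cases hg : g = 1
  · rw [hg, single_one, List.nil_append]
  · rw [single_of_ne hg]
    exact headAt_cons_of_adj (a := ⟨β, g, hg⟩) h w

theorem tailAt_single_append_of_adj (h : I.Adj α β) (g : G β) (w : Word G) :
    tailAt I α (single β g ++ w) = single β g ++ tailAt I α w := by
  by_cases hg : g = 1
  · rw [hg, single_one, List.nil_append, List.nil_append]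
  · rw [single_of_ne hg]
    exact tailAt_cons_of_adj (a := ⟨β, g, hg⟩) h w

theorem headAt_single_append_of_compl_adj (h : Iᶜ.Adj α β) {g : G β} (hg : g ≠ 1) (w : Word G) :
    headAt I α (single β g ++ w) = 1 := by
  rw [single_of_ne hg]
  exact headAt_cons_of_compl_adj (a := ⟨β, g, hg⟩) h w

theorem traceEq_single_append_comm (h : I.Adj α β) (g : G α) (k : G β) (w : Word G) :
    TraceEq I (single α g ++ (single β k ++ w)) (single β k ++ (single α g ++ w)) := by
  by_cases hg : g = 1
  · rw [hg, single_one, List.nil_append, List.nil_append]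
  by_cases hk : k = 1
  · rw [hk, single_one, List.nil_append, List.nil_append]
  · rw [single_of_ne hg, single_of_ne hk]
    exact .swap ⟨α, g, hg⟩ ⟨β, k, hk⟩ w h

theorem traceEq_single_headAt_append_tailAt (α : L) (w : Word G) :
    TraceEq I w (single α (headAt I α w) ++ tailAt I α w) := by
  induction w with
  | nil => rw [headAt_nil, single_one, tailAt_nil, List.nil_append]
  | cons a w ih =>
    obtain rfl | hadj | hadj := eq_or_adj_or_compl_adj I α a.node
    · rw [headAt_cons_self, tailAt_cons_self, single_val, List.singleton_append]
    · rw [headAt_cons_of_adj hadj, tailAt_cons_of_adj hadj]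
      refine (ih.cons a).trans ?_
      simpa [single_val] using
        traceEq_single_append_comm hadj.symm a.val (headAt I α w) (tailAt I α w)
    · rw [headAt_cons_of_compl_adj hadj, tailAt_cons_of_compl_adj hadj, single_one,
        List.nil_append]

theorem traceEq_cons_tailAt (h : headAt I α w ≠ 1) :
    TraceEq I w (⟨α, headAt I α w, h⟩ :: tailAt I α w) := by
  simpa only [single_of_ne h, List.singleton_append] using
    traceEq_single_headAt_append_tailAt (I := I) α w

namespace TraceEq

theorem headAt_eq (α : L) (h : TraceEq I u v) : headAt I α u = headAt I α v := by
  induction h with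
  | nil => rfl
  | cons a _ ih =>
    obtain rfl | hadj | hadj := eq_or_adj_or_compl_adj I α a.node
    · rw [headAt_cons_self, headAt_cons_self]
    · rw [headAt_cons_of_adj hadj, headAt_cons_of_adj hadj, ih]
    · rw [headAt_cons_of_compl_adj hadj, headAt_cons_of_compl_adj hadj]
  | swap a b u hab =>
    by_cases ha : α = a.node
    · subst ha
      rw [headAt_cons_of_adj hab, headAt_cons_self, headAt_cons_self]
    by_cases hb : α = b.node
    · subst hb
      rw [headAt_cons_of_adj hab.symm, headAt_cons_self, headAt_cons_self]
    obtain ha | ha := (eq_or_adj_or_compl_adj I α a.node).resolve_left ha <;>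
    obtain hb | hb := (eq_or_adj_or_compl_adj I α b.node).resolve_left hb <;>
    simp only [headAt_cons_of_adj, headAt_cons_of_compl_adj, *]
  | trans _ _ ih₁ ih₂ => exact ih₁.trans ih₂

theorem tailAt_congr (α : L) (h : TraceEq I u v) : TraceEq I (tailAt I α u) (tailAt I α v) := by
  induction h with
  | nil => exact .rfl
  | cons a h ih =>
    obtain rfl | hadj | hadj := eq_or_adj_or_compl_adj I α a.node
    · rwa [tailAt_cons_self, tailAt_cons_self]
    · rw [tailAt_cons_of_adj hadj, tailAt_cons_of_adj hadj]
      exact ih.cons a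
    · rw [tailAt_cons_of_compl_adj hadj, tailAt_cons_of_compl_adj hadj]
      exact h.cons a
  | swap a b u hab =>
    by_cases ha : α = a.node
    · subst ha
      rw [tailAt_cons_of_adj hab, tailAt_cons_self, tailAt_cons_self]
    by_cases hb : α = b.node
    · subst hb
      rw [tailAt_cons_of_adj hab.symm, tailAt_cons_self, tailAt_cons_self]
    obtain ha | ha := (eq_or_adj_or_compl_adj I α a.node).resolve_left ha <;>
    obtain hb | hb := (eq_or_adj_or_compl_adj I α b.node).resolve_left hb <;>
    simp only [tailAt_cons_of_adj, tailAt_cons_of_compl_adj, *] <;>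
    exact swap a b _ hab
  | trans _ _ ih₁ ih₂ => exact ih₁.trans ih₂

end TraceEq

end Head

/-! ### Reduced words -/

section Reduced

variable {α : L} {a : Letter G} {u v w : Word G}

theorem isMinVertex_cons_zero : IsMinVertex I (a :: w) (0 : Fin (w.length + 1)) :=
  not_arc_cons_zero

theorem isMinVertex_cons_succ {i : Fin w.length} :
    IsMinVertex I (a :: w) i.succ ↔ I.Adj a.node (w.get i).node ∧ IsMinVertex I w i :=
  Fin.forall_fin_succ.trans <|
    and_congr (by rw [arc_cons_zero_succ, not_not])
      (forall_congr' fun _ => not_congr arc_cons_succ_succ)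

theorem isMaxVertex_cons_zero :
    IsMaxVertex I (a :: w) (0 : Fin (w.length + 1)) ↔ IsIndep I a.node w := by
  refine Fin.forall_fin_succ.trans <| (and_iff_right (not_arc_cons_zero _)).trans ?_
  simp only [arc_cons_zero_succ, not_not, IsIndep, List.forall_mem_iff_get]

theorem isMaxVertex_cons_succ {i : Fin w.length} :
    IsMaxVertex I (a :: w) i.succ ↔ IsMaxVertex I w i :=
  Fin.forall_fin_succ.trans <|
    (and_iff_right (not_arc_cons_zero _)).trans
      (forall_congr' fun _ => not_congr arc_cons_succ_succ)

theorem headAt_ne_one_iff :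
    headAt I α w ≠ 1 ↔ ∃ i, IsMinVertex I w i ∧ (w.get i).node = α := by
  induction w with
  | nil => exact iff_of_false (fun h => h rfl) fun ⟨i, _⟩ => i.elim0
  | cons a w ih =>
    refine Iff.trans ?_ Fin.exists_fin_succ.symm
    simp only [isMinVertex_cons_zero, isMinVertex_cons_succ, true_and]
    change _ ↔ a.node = α ∨ ∃ i, (I.Adj a.node (w.get i).node ∧ _) ∧ (w.get i).node = α
    obtain rfl | hadj | hadj := eq_or_adj_or_compl_adj I α a.node
    · simpa [headAt_cons_self] using a.ne_one
    · rw [headAt_cons_of_adj hadj, ih, or_iff_right hadj.ne']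
      refine exists_congr fun i => and_congr_left ?_
      rintro rfl
      exact (and_iff_right hadj.symm).symm
    · refine iff_of_false (fun h => h (headAt_cons_of_compl_adj hadj w)) ?_
      rw [SimpleGraph.compl_adj] at hadj
      rintro (rfl | ⟨i, ⟨hi, -⟩, rfl⟩)
      · exact hadj.1 rfl
      · exact hadj.2 hi.symm

theorem headAt_inv_ne_one_iff :
    headAt I α w.inv ≠ 1 ↔ ∃ i, IsMaxVertex I w i ∧ (w.get i).node = α := by
  induction w with
  | nil => exact iff_of_false (fun h => h rfl) fun ⟨i, _⟩ => i.elim0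
  | cons a w ih =>
    refine Iff.trans ?_ Fin.exists_fin_succ.symm
    simp only [isMaxVertex_cons_zero, isMaxVertex_cons_succ, Word.inv_cons]
    change _ ↔ _ ∧ a.node = α ∨ ∃ i, _ ∧ (w.get i).node = α
    rw [← ih]
    by_cases hα : IsIndep I α w
    · rw [headAt_append_of_isIndep (isIndep_inv.2 hα), headAt_singleton_ne_one_iff,
        headAt_of_isIndep (isIndep_inv.2 hα), Letter.node_inv, ne_self_iff_false, or_false]
      exact (and_iff_right_of_imp fun h => h ▸ hα).symm
    · rw [headAt_append_of_not_isIndep (mt isIndep_inv.1 hα), or_iff_right]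
      rintro ⟨h, rfl⟩
      exact hα h

theorem hasseArc_cons_succ_succ {i j : Fin w.length} :
    HasseArc I (a :: w) i.succ j.succ ↔ HasseArc I w i j := by
  refine and_congr arc_cons_succ_succ (not_congr (Fin.exists_fin_succ.trans ?_))
  simp only [not_arc_cons_zero, arc_cons_succ_succ, false_and, false_or]

theorem hasseArc_cons_zero_succ_of_node_eq {j : Fin w.length} (h : a.node = (w.get j).node) :
    HasseArc I (a :: w) (0 : Fin (w.length + 1)) j.succ ↔ IsMinVertex I w j := by
  have harc : Arc I (a :: w) (0 : Fin (w.length + 1)) j.succ := by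
    rw [arc_cons_zero_succ, ← h]
    exact I.irrefl
  refine (and_iff_right harc).trans <| (not_congr Fin.exists_fin_succ).trans ?_
  simp only [not_arc_cons_zero, arc_cons_zero_succ, arc_cons_succ_succ, false_and, false_or,
    not_exists, IsMinVertex]
  refine forall_congr' fun k => not_congr (and_iff_right_of_imp fun hkj => ?_)
  rw [h, I.adj_comm]
  exact hkj.2

theorem isReduced_nil : IsReduced I ([] : Word G) := fun i => i.elim0

theorem isReduced_cons : IsReduced I (a :: w) ↔ headAt I a.node w = 1 ∧ IsReduced I w := by
  have hzero : (∀ j : Fin w.length, HasseArc I (a :: w) (0 : Fin (w.length + 1)) j.succ →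
      a.node ≠ (w.get j).node) ↔ headAt I a.node w = 1 := by
    rw [← not_iff_not, ← ne_eq, headAt_ne_one_iff]
    push Not
    refine exists_congr fun j => ?_
    rw [eq_comm (b := a.node), and_congr_left hasseArc_cons_zero_succ_of_node_eq]
  refine Fin.forall_fin_succ.trans (and_congr ?_ (forall_congr' fun i => ?_))
  · refine Fin.forall_fin_succ.trans <| (and_iff_right fun h => ?_).trans hzero
    exact absurd h.1 (not_arc_cons_zero _)
  · refine Fin.forall_fin_succ.trans <| (and_iff_right fun h => ?_).trans <|
      forall_congr' fun j => imp_congr_left hasseArc_cons_succ_succ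
    exact absurd h.1 (not_arc_cons_zero _)

theorem TraceEq.isReduced_iff (h : TraceEq I u v) : IsReduced I u ↔ IsReduced I v := by
  induction h with
  | nil => exact Iff.rfl
  | cons a h ih => rw [isReduced_cons, isReduced_cons, h.headAt_eq, ih]
  | swap a b u hab =>
    simp only [isReduced_cons, headAt_cons_of_adj, hab, hab.symm]
    exact and_left_comm
  | trans _ _ ih₁ ih₂ => exact ih₁.trans ih₂

namespace IsReduced

theorem headAt_tailAt_and_isReduced_tailAt (h : IsReduced I w) (α : L) :
    headAt I α (tailAt I α w) = 1 ∧ IsReduced I (tailAt I α w) := by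
  by_cases hα : headAt I α w = 1
  · rw [tailAt_eq_self hα]
    exact ⟨hα, h⟩
  · exact isReduced_cons.1 ((traceEq_cons_tailAt hα).isReduced_iff.1 h)

theorem headAt_tailAt (h : IsReduced I w) (α : L) : headAt I α (tailAt I α w) = 1 :=
  (h.headAt_tailAt_and_isReduced_tailAt α).1

theorem isReduced_tailAt (h : IsReduced I w) (α : L) : IsReduced I (tailAt I α w) :=
  (h.headAt_tailAt_and_isReduced_tailAt α).2

theorem single_append (h : IsReduced I w) (hα : headAt I α w = 1) (g : G α) :
    IsReduced I (single α g ++ w) := by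
  by_cases hg : g = 1
  · rwa [hg, single_one]
  · rw [single_of_ne hg]
    exact isReduced_cons.2 ⟨hα, h⟩

theorem concat (h : IsReduced I w) (ha : headAt I a.node w.inv = 1) : IsReduced I (w ++ [a]) := by
  induction w with
  | nil => exact isReduced_cons.2 ⟨headAt_nil, isReduced_nil⟩
  | cons b w ih =>
    rw [isReduced_cons] at h
    rw [Word.inv_cons] at ha
    have ha' : headAt I a.node (Word.inv w) = 1 := by
      by_contra hne
      exact hne (headAt_append_of_ne_one hne _ ▸ ha)
    rw [List.cons_append]
    refine isReduced_cons.2 ⟨?_, ih h.2 ha'⟩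
    by_cases hb : IsIndep I b.node w
    · rw [headAt_append_of_isIndep hb]
      by_contra hne
      rw [← ne_eq, headAt_singleton_ne_one_iff] at hne
      rw [hne, headAt_append_of_isIndep (isIndep_inv.2 hb)] at ha
      exact headAt_singleton_ne_one_iff.2 b.node_inv ha
    · rw [headAt_append_of_not_isIndep hb, h.1]

theorem inv (h : IsReduced I w) : IsReduced I w.inv := by
  induction w with
  | nil => exact isReduced_nil
  | cons a w ih =>
    rw [isReduced_cons] at h
    rw [Word.inv_cons]
    refine (ih h.2).concat ?_
    rw [Word.inv_inv]
    exact h.1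

end IsReduced

end Reduced

/-! ### The action on reduced traces -/

/-- The action of `g : G α` on words: `g` is multiplied to the first letter in `G α`. On reduced
words it represents left multiplication by `g` in the graph product. -/
noncomputable def actNode (I : SimpleGraph L) (α : L) (g : G α) (w : Word G) : Word G :=
  single α (g * headAt I α w) ++ tailAt I α w

section Action

variable {α β : L} {a : Letter G} {u v w : Word G}

theorem actNode_one (α : L) (w : Word G) : TraceEq I (actNode I α 1 w) w := by
  rw [actNode, one_mul]
  exact (traceEq_single_headAt_append_tailAt α w).symm

theorem actNode_comm (h : I.Adj α β) (g : G α) (k : G β) (w : Word G) :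
    TraceEq I (actNode I α g (actNode I β k w)) (actNode I β k (actNode I α g w)) := by
  simp only [actNode, headAt_single_append_of_adj, headAt_tailAt_of_adj,
    tailAt_single_append_of_adj, h, h.symm, tailAt_comm h]
  exact traceEq_single_append_comm h _ _ _

theorem headAt_actNode_of_adj (h : I.Adj α β) (k : G β) (w : Word G) :
    headAt I α (actNode I β k w) = headAt I α w := by
  rw [actNode, headAt_single_append_of_adj h, headAt_tailAt_of_adj h]

theorem headAt_actNode_of_compl_adj (h : Iᶜ.Adj α β) {k : G β} (hk : k * headAt I β w ≠ 1) :
    headAt I α (actNode I β k w) = 1 :=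
  headAt_single_append_of_compl_adj h hk _

theorem TraceEq.actNode_congr (h : TraceEq I u v) (g : G α) :
    TraceEq I (actNode I α g u) (actNode I α g v) := by
  rw [actNode, actNode, h.headAt_eq]
  exact (h.tailAt_congr α).append_left _

theorem actNode_letter (h : headAt I a.node w = 1) : actNode I a.node a.val w = a :: w := by
  rw [actNode, h, mul_one, tailAt_eq_self h, single_val, List.singleton_append]

theorem toGroup_single (g : G α) : (single α g).toGroup I = GraphProduct.of I α g := by
  by_cases hg : g = 1
  · rw [hg, single_one, map_one, Word.toGroup_nil]
  · rw [single_of_ne hg, Word.toGroup_singleton]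

theorem toGroup_actNode (g : G α) (w : Word G) :
    (actNode I α g w).toGroup I = GraphProduct.of I α g * w.toGroup I := by
  rw [(traceEq_single_headAt_append_tailAt α w).toGroup_eq, actNode, Word.toGroup_append,
    Word.toGroup_append, toGroup_single, toGroup_single, map_mul, mul_assoc]

namespace IsReduced

theorem actNode (h : IsReduced I w) (g : G α) : IsReduced I (actNode I α g w) :=
  (h.isReduced_tailAt α).single_append (h.headAt_tailAt α) _

theorem headAt_actNode (h : IsReduced I w) (g : G α) :
    headAt I α (GraphProd.actNode I α g w) = g * headAt I α w :=
  headAt_single_append _ (h.headAt_tailAt α)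

theorem actNode_mul (h : IsReduced I w) (g k : G α) :
    GraphProd.actNode I α (g * k) w = GraphProd.actNode I α g (GraphProd.actNode I α k w) := by
  have htail : tailAt I α (GraphProd.actNode I α k w) = tailAt I α w :=
    tailAt_single_append _ (h.headAt_tailAt α)
  rw [GraphProd.actNode, GraphProd.actNode, htail, h.headAt_actNode, mul_assoc]

end IsReduced

/-- Traces of reduced words; they will turn out to be normal forms for the elements of the graph
product. -/
def ReducedTrace (I : SimpleGraph L) (G : L → Type v) [∀ α, Group (G α)] : Type (max u v) :=
  Quotient ((traceSetoid I).comap (Subtype.val : {w : Word G // IsReduced I w} → Word G))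

namespace ReducedTrace

/-- The trace of a reduced word. -/
def mk (w : Word G) (h : IsReduced I w) : ReducedTrace I G := Quotient.mk _ ⟨w, h⟩

theorem mk_eq_mk_iff {hu : IsReduced I u} {hv : IsReduced I v} :
    mk u hu = mk v hv ↔ TraceEq I u v :=
  Quotient.eq

/-- The action of a node group on reduced traces that is induced by `actNode`. -/
noncomputable def nodeAction (I : SimpleGraph L) (α : L) :
    G α →* Function.End (ReducedTrace I G) where
  toFun g := Quotient.map (fun w => ⟨actNode I α g w.1, w.2.actNode g⟩) fun _ _ h =>
    TraceEq.actNode_congr h g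
  map_one' :=
    funext <| Quotient.ind fun w => mk_eq_mk_iff.2 (actNode_one α w.1)
  map_mul' g k :=
    funext <| Quotient.ind fun w => congrArg (Quotient.mk _) (Subtype.ext (w.2.actNode_mul g k))

theorem nodeAction_mk (g : G α) (h : IsReduced I w) :
    nodeAction I α g • mk w h = mk (actNode I α g w) (h.actNode g) := rfl

theorem commute_nodeAction (h : I.Adj α β) (g : G α) (k : G β) :
    Commute (nodeAction I α g) (nodeAction I β k) :=
  funext <| Quotient.ind fun w => mk_eq_mk_iff.2 (actNode_comm h g k w.1)

/-- The action of the graph product on reduced traces. -/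
noncomputable def action (I : SimpleGraph L) :
    GraphProduct I G →* Function.End (ReducedTrace I G) :=
  GraphProduct.lift (nodeAction I) fun _ _ h => commute_nodeAction h

theorem action_of (g : G α) : action I (GraphProduct.of I α g) = nodeAction I α g :=
  GraphProduct.lift_of ..

theorem action_toGroup (h : IsReduced I w) :
    action I (w.toGroup I) • mk [] isReduced_nil = mk w h := by
  induction w with
  | nil => rw [Word.toGroup_nil, map_one, one_smul]
  | cons a w ih =>
    have h' := isReduced_cons.1 h
    rw [Word.toGroup_cons, map_mul, mul_smul, ih h'.2, action_of, nodeAction_mk]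
    simp only [actNode_letter h'.1]

end ReducedTrace

theorem IsReduced.traceEq_of_toGroup_eq (hu : IsReduced I u) (hv : IsReduced I v)
    (h : u.toGroup I = v.toGroup I) : TraceEq I u v := by
  rw [← ReducedTrace.mk_eq_mk_iff (hu := hu) (hv := hv), ← ReducedTrace.action_toGroup hu,
    ← ReducedTrace.action_toGroup hv, h]

end Action

/-! ### Products without cancellation -/

/-- A word for the product of the words `u` and `v` in the graph product, which is reduced if `v`
is. -/
noncomputable def actWord (I : SimpleGraph L) (u v : Word G) : Word G :=
  u.foldr (fun a w => actNode I a.node a.val w) v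

/-- The traces of `u` and `v` have a common first letter. If those of `u⁻¹` and `v` have none, then
letters may merge in the product of `u` and `v`, but none cancel. -/
def CommonHead (I : SimpleGraph L) (u v : Word G) : Prop :=
  ∃ α, headAt I α u ≠ 1 ∧ headAt I α u = headAt I α v

section Product

variable {α : L} {a : Letter G} {u v w : Word G}

theorem actWord_cons (a : Letter G) (u v : Word G) :
    actWord I (a :: u) v = actNode I a.node a.val (actWord I u v) := rfl

theorem toGroup_actWord (u v : Word G) :
    (actWord I u v).toGroup I = u.toGroup I * v.toGroup I := by
  induction u with
  | nil => exact (one_mul _).symm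
  | cons a u ih => rw [actWord_cons, toGroup_actNode, ih, Word.toGroup_cons, mul_assoc]

theorem IsReduced.actWord (hv : IsReduced I v) (u : Word G) : IsReduced I (actWord I u v) := by
  induction u with
  | nil => exact hv
  | cons a u ih => exact ih.actNode a.val

theorem exists_isReduced_toGroup_eq (g : GraphProduct I G) :
    ∃ w : Word G, IsReduced I w ∧ w.toGroup I = g := by
  obtain ⟨u, rfl⟩ := Word.toGroup_surjective g
  exact ⟨actWord I u [], isReduced_nil.actWord u, by
    rw [toGroup_actWord, Word.toGroup_nil, mul_one]⟩

theorem headAt_actWord_of_isIndep (h : IsIndep I α u) (v : Word G) :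
    headAt I α (actWord I u v) = headAt I α v := by
  induction u with
  | nil => rfl
  | cons a u ih =>
    rw [isIndep_cons] at h
    rw [actWord_cons, headAt_actNode_of_adj h.1, ih h.2]

theorem CommonHead.symm (h : CommonHead I u v) : CommonHead I v u := by
  obtain ⟨α, hα, huv⟩ := h
  exact ⟨α, huv ▸ hα, huv.symm⟩

theorem CommonHead.append (h : CommonHead I u v) (w : Word G) : CommonHead I (u ++ w) v := by
  obtain ⟨α, hα, huv⟩ := h
  refine ⟨α, ?_⟩
  rw [headAt_append_of_ne_one hα]
  exact ⟨hα, huv⟩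

theorem IsReduced.headAt_actWord_eq_one_iff (hu : IsReduced I u) (hv : IsReduced I v)
    (huv : ¬ CommonHead I u.inv v) (hα : ¬ IsIndep I α u) :
    headAt I α (GraphProd.actWord I u v) = 1 ↔ headAt I α u = 1 := by
  induction u generalizing α with
  | nil => exact absurd (by simp [IsIndep]) hα
  | cons a u ih =>
    rw [isReduced_cons] at hu
    rw [Word.inv_cons] at huv
    have huv' : ¬ CommonHead I (Word.inv u) v := mt (CommonHead.append · _) huv
    have hne : a.val * headAt I a.node (GraphProd.actWord I u v) ≠ 1 := by
      by_cases ha : IsIndep I a.node u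
      · rw [headAt_actWord_of_isIndep ha]
        refine fun h => huv ⟨a.node, ?_⟩
        rw [headAt_append_of_isIndep (isIndep_inv.2 ha), eq_inv_of_mul_eq_one_right h]
        exact ⟨headAt_singleton_ne_one_iff.2 a.node_inv, headAt_cons_self a⁻¹ []⟩
      · rw [(ih hu.2 huv' ha).2 hu.1, mul_one]
        exact a.ne_one
    rw [actWord_cons]
    obtain rfl | hadj | hadj := eq_or_adj_or_compl_adj I α a.node
    · rw [(hv.actWord u).headAt_actNode, headAt_cons_self]
      exact iff_of_false hne a.ne_one
    · rw [isIndep_cons, not_and] at hα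
      rw [headAt_actNode_of_adj hadj, headAt_cons_of_adj hadj, ih hu.2 huv' (hα hadj)]
    · rw [headAt_actNode_of_compl_adj hadj hne, headAt_cons_of_compl_adj hadj]

end Product

/-! ### Conjugacy and transposition -/

/-- Cyclic reducedness of `w` without the proviso `i ≠ j`. This excludes those cyclically reduced
words that contain a letter independent of all the others. -/
def IsStrictlyCyclicallyReduced (I : SimpleGraph L) (w : Word G) : Prop :=
  IsReduced I w ∧ ∀ i j, IsMinVertex I w i → IsMaxVertex I w j → (w.get i).node ≠ (w.get j).node

section Conjugacy

variable {a : Letter G} {u v w x y : Word G}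

theorem isStrictlyCyclicallyReduced_iff :
    IsStrictlyCyclicallyReduced I w ↔
      IsReduced I w ∧ ∀ α, headAt I α w = 1 ∨ headAt I α w.inv = 1 := by
  refine and_congr_right fun _ => ⟨fun h α => ?_, fun h i j hi hj hij => ?_⟩
  · by_contra! hα
    obtain ⟨i, hi, rfl⟩ := headAt_ne_one_iff.1 hα.1
    obtain ⟨j, hj, hij⟩ := headAt_inv_ne_one_iff.1 hα.2
    exact h i j hi hj hij.symm
  · obtain h | h := h (w.get i).node
    · exact headAt_ne_one_iff.2 ⟨i, hi, rfl⟩ h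
    · exact headAt_inv_ne_one_iff.2 ⟨j, hj, hij.symm⟩ h

theorem TraceEq.isStrictlyCyclicallyReduced_iff (h : TraceEq I u v) :
    IsStrictlyCyclicallyReduced I u ↔ IsStrictlyCyclicallyReduced I v := by
  simp only [GraphProd.isStrictlyCyclicallyReduced_iff, h.isReduced_iff, h.headAt_eq,
    h.inv.headAt_eq]

namespace IsStrictlyCyclicallyReduced

theorem isReduced (h : IsStrictlyCyclicallyReduced I w) : IsReduced I w := h.1

theorem inv (h : IsStrictlyCyclicallyReduced I w) : IsStrictlyCyclicallyReduced I w.inv := by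
  rw [isStrictlyCyclicallyReduced_iff] at h ⊢
  refine ⟨h.1.inv, fun α => ?_⟩
  rw [Word.inv_inv]
  exact (h.2 α).symm

theorem headAt_inv_eq_one (h : IsStrictlyCyclicallyReduced I w) {α : L} (hα : headAt I α w ≠ 1) :
    headAt I α w.inv = 1 :=
  ((isStrictlyCyclicallyReduced_iff.1 h).2 α).resolve_left hα

theorem rotate (h : IsStrictlyCyclicallyReduced I (a :: w)) :
    IsStrictlyCyclicallyReduced I (w ++ [a]) := by
  obtain ⟨haw, hw⟩ := isReduced_cons.1 h.isReduced
  have hinv : headAt I a.node (w.inv ++ [a⁻¹]) = 1 := by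
    rw [← Word.inv_cons]
    refine h.headAt_inv_eq_one ?_
    rw [headAt_cons_self]
    exact a.ne_one
  have hinv' : headAt I a.node w.inv = 1 := by
    by_contra hne
    exact hne (headAt_append_of_ne_one hne _ ▸ hinv)
  have hdep : ¬ IsIndep I a.node w := by
    intro hw
    rw [headAt_append_of_isIndep (isIndep_inv.2 hw)] at hinv
    exact headAt_singleton_ne_one_iff.2 a.node_inv hinv
  refine isStrictlyCyclicallyReduced_iff.2 ⟨hw.concat hinv', fun α => ?_⟩
  rw [Word.inv_concat]
  obtain rfl | hadj | hadj := eq_or_adj_or_compl_adj I α a.node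
  · rw [headAt_append_of_not_isIndep hdep]
    exact .inl haw
  · rw [headAt_concat_of_adj w hadj, headAt_cons_of_adj (a := a⁻¹) hadj]
    have hα := (isStrictlyCyclicallyReduced_iff.1 h).2 α
    rwa [headAt_cons_of_adj hadj, Word.inv_cons, headAt_concat_of_adj (a := a⁻¹) _ hadj] at hα
  · exact .inr (headAt_cons_of_compl_adj (a := a⁻¹) hadj _)

end IsStrictlyCyclicallyReduced

namespace Transposed

theorem symm : Transposed I u v → Transposed I v u := fun ⟨r, s, hu, hv⟩ => ⟨s, r, hv, hu⟩

theorem inv (h : Transposed I u v) : Transposed I u.inv v.inv := by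
  obtain ⟨r, s, hu, hv⟩ := h
  refine ⟨s.inv, r.inv, ?_, ?_⟩
  · rw [← Word.inv_append]
    exact hu.traceEq.inv.depIso
  · rw [← Word.inv_append]
    exact hv.traceEq.inv.depIso

theorem isConj (h : Transposed I u v) : IsConj (u.toGroup I) (v.toGroup I) := by
  obtain ⟨r, s, hu, hv⟩ := h
  rw [hu.traceEq.toGroup_eq, hv.traceEq.toGroup_eq, Word.toGroup_append, Word.toGroup_append,
    isConj_iff]
  exact ⟨s.toGroup I, by group⟩

end Transposed

theorem TraceEq.transposed (h : TraceEq I u v) : Transposed I u v :=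
  ⟨u, [], by rw [List.append_nil]; exact .refl u, h.symm.depIso⟩

namespace TranspositionEquiv

theorem symm (h : TranspositionEquiv I u v) : TranspositionEquiv I v u := by
  induction h with
  | single h => exact .single h.symm
  | tail _ h ih => exact .head h.symm ih

theorem inv (h : TranspositionEquiv I u v) : TranspositionEquiv I u.inv v.inv :=
  Relation.TransGen.lift Word.inv (fun _ _ => Transposed.inv) _ _ h

theorem of_inv (h : TranspositionEquiv I u.inv v.inv) : TranspositionEquiv I u v := by
  simpa only [Word.inv_inv] using h.inv

theorem isConj (h : TranspositionEquiv I u v) : IsConj (u.toGroup I) (v.toGroup I) := by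
  induction h with
  | single h => exact h.isConj
  | tail _ h ih => exact ih.trans h.isConj

end TranspositionEquiv

/-- The reduced word `w` conjugates `x` to `y`, both of them strictly cyclically reduced: in the
graph product, `wx = yw`. -/
structure IsConjugator (I : SimpleGraph L) (w x y : Word G) : Prop where
  isReduced : IsReduced I w
  left : IsStrictlyCyclicallyReduced I x
  right : IsStrictlyCyclicallyReduced I y
  semiconjBy : SemiconjBy (w.toGroup I) (x.toGroup I) (y.toGroup I)

namespace IsConjugator

theorem inv (h : IsConjugator I w x y) : IsConjugator I w x.inv y.inv where
  isReduced := h.isReduced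
  left := h.left.inv
  right := h.right.inv
  semiconjBy := by
    rw [Word.toGroup_inv, Word.toGroup_inv]
    exact h.semiconjBy.inv_right

theorem symm (h : IsConjugator I w x y) : IsConjugator I w.inv y x where
  isReduced := h.isReduced.inv
  left := h.right
  right := h.left
  semiconjBy := by
    rw [Word.toGroup_inv]
    exact h.semiconjBy.inv_symm_left

theorem exists_shorter (h : IsConjugator I w x y) (hyw : CommonHead I y w) :
    ∃ w' y', w'.length < w.length ∧ IsConjugator I w' x y' ∧ Transposed I y' y := by
  obtain ⟨α, hα, heq⟩ := hyw
  let a : Letter G := ⟨α, headAt I α y, hα⟩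
  have hy : TraceEq I y (a :: tailAt I α y) := traceEq_cons_tailAt hα
  have hw : TraceEq I w (a :: tailAt I α w) := by
    simpa only [a, heq] using traceEq_cons_tailAt (heq ▸ hα)
  refine ⟨tailAt I α w, tailAt I α y ++ [a], ?_, ?_, ?_⟩
  · rw [hw.perm.length_eq]
    exact Nat.lt_succ_self _
  · refine ⟨h.isReduced.isReduced_tailAt α, h.left,
      (hy.isStrictlyCyclicallyReduced_iff.1 h.right).rotate, ?_⟩
    have hconj := h.semiconjBy
    rw [SemiconjBy, hw.toGroup_eq, hy.toGroup_eq, Word.toGroup_cons, Word.toGroup_cons, mul_assoc,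
      mul_assoc, mul_right_inj] at hconj
    rwa [SemiconjBy, Word.toGroup_append, Word.toGroup_singleton, mul_assoc]
  · exact ⟨_, [a], .refl _, hy.depIso⟩

theorem headAt_ne_one (h : IsConjugator I (a :: w) x y) (hyw : ¬ CommonHead I y.inv (a :: w))
    (hwx : ¬ CommonHead I (Word.inv (a :: w)) x) (hdep : ¬ IsIndep I a.node y) :
    headAt I a.node y ≠ 1 := by
  have htrace : TraceEq I (actWord I (a :: w) x) (actWord I y (a :: w)) := by
    refine (h.left.isReduced.actWord _).traceEq_of_toGroup_eq (h.isReduced.actWord _) ?_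
    rw [toGroup_actWord, toGroup_actWord]
    exact h.semiconjBy
  have hself : ¬ IsIndep I a.node (a :: w) := fun ha => I.irrefl (isIndep_cons.1 ha).1
  rw [ne_eq, ← h.right.isReduced.headAt_actWord_eq_one_iff h.isReduced hyw hdep,
    ← htrace.headAt_eq, h.isReduced.headAt_actWord_eq_one_iff h.left.isReduced hwx hself,
    headAt_cons_self]
  exact a.ne_one

theorem tail (h : IsConjugator I (a :: w) x y) (ha : IsIndep I a.node y) :
    IsConjugator I w x y where
  isReduced := (isReduced_cons.1 h.isReduced).2
  left := h.left
  right := h.right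
  semiconjBy := by
    have hconj := h.semiconjBy
    rwa [SemiconjBy, Word.toGroup_cons, ← mul_assoc, ← (ha.commute_toGroup a.val).eq, mul_assoc,
      mul_assoc, mul_right_inj] at hconj

theorem transpositionEquiv (h : IsConjugator I w x y) : TranspositionEquiv I x y := by
  induction hn : w.length using Nat.strong_induction_on generalizing w x y with
  | h n ih =>
    have of_commonHead {w x y : Word G} (h : IsConjugator I w x y) (hlen : w.length = n)
        (hyw : CommonHead I y w) : TranspositionEquiv I x y := by
      obtain ⟨w', y', hlt, h', htrans⟩ := h.exists_shorter hyw
      exact (ih _ (hlen ▸ hlt) h' rfl).tail htrans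
    have hn' : w.inv.length = n := by rw [Word.length_inv, hn]
    by_cases hyw : CommonHead I y w
    · exact of_commonHead h hn hyw
    by_cases hyw' : CommonHead I y.inv w
    · exact (of_commonHead h.inv hn hyw').of_inv
    by_cases hwx : CommonHead I w.inv x
    · exact (of_commonHead h.symm hn' hwx.symm).symm
    by_cases hwx' : CommonHead I w.inv x.inv
    · exact (of_commonHead h.inv.symm hn' hwx'.symm).symm.of_inv
    cases w with
    | nil =>
      refine .single (h.left.isReduced.traceEq_of_toGroup_eq h.right.isReduced ?_).transposed
      simpa only [SemiconjBy, Word.toGroup_nil, one_mul, mul_one] using h.semiconjBy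
    | cons a w =>
      have ha : IsIndep I a.node y := by
        by_contra hdep
        refine h.inv.headAt_ne_one ?_ hwx' (mt isIndep_inv.1 hdep) ?_
        · rwa [Word.inv_inv]
        · exact h.right.headAt_inv_eq_one (h.headAt_ne_one hyw' hwx hdep)
      exact ih _ (hn ▸ Nat.lt_succ_self _) (h.tail ha) rfl

end IsConjugator

end Conjugacy

theorem IsConnected.not_isMaxVertex_of_isMinVertex {w : Word G} (hw : IsConnected I w)
    (hal : (al w).Nontrivial) {i : Fin w.length} (hi : IsMinVertex I w i) :
    ¬ IsMaxVertex I w i := by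
  intro hi'
  have := hal.coe_sort
  have hmem : (w.get i).node ∈ al w := ⟨_, w.get_mem i, rfl⟩
  obtain ⟨⟨_, b, hb, rfl⟩, hadj⟩ := hw.preconnected.exists_adj_of_nontrivial ⟨_, hmem⟩
  obtain ⟨j, rfl⟩ := List.mem_iff_get.1 hb
  obtain ⟨hne, hdep⟩ := (SimpleGraph.compl_adj ..).1 hadj
  obtain hij | rfl | hij := lt_trichotomy i j
  · exact hi' j ⟨hij, hdep⟩
  · exact hne rfl
  · exact hi j ⟨hij, fun h => hdep h.symm⟩

theorem IsCyclicallyReduced.isStrictlyCyclicallyReduced {w : Word G}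
    (h : IsCyclicallyReduced I w) (hw : IsConnected I w) (hal : (al w).Nontrivial) :
    IsStrictlyCyclicallyReduced I w := by
  refine ⟨h.1, fun i j hi hj => h.2 i j hi hj ?_⟩
  rintro rfl
  exact hw.not_isMaxVertex_of_isMinVertex hal hi hj

end GraphProd

theorem mainTheorem7_general {L : Type*} {I : SimpleGraph L} {G : L → Type*} [∀ α, Group (G α)]
    {x y : GraphProd.Word G} (hx : GraphProd.IsStrictlyCyclicallyReduced I x)
    (hy : GraphProd.IsStrictlyCyclicallyReduced I y) :
    IsConj (GraphProd.Word.toGroup I x) (GraphProd.Word.toGroup I y) ↔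
      GraphProd.TranspositionEquiv I x y := by
  refine ⟨fun ⟨c, hc⟩ => ?_, GraphProd.TranspositionEquiv.isConj⟩
  obtain ⟨w, hw, hwc⟩ := GraphProd.exists_isReduced_toGroup_eq (c : GraphProd.GraphProduct I G)
  exact GraphProd.IsConjugator.transpositionEquiv ⟨hw, hx, hy, hwc ▸ hc⟩

theorem mainTheorem7 {L : Type*} [Finite L] (I : SimpleGraph L) (G : L → Type*)
    [∀ α, Group (G α)] [∀ α, Nontrivial (G α)] [∀ α, Group.FG (G α)]
    (x y : GraphProd.Word G)
    (hx : GraphProd.IsCyclicallyReduced I x) (hy : GraphProd.IsCyclicallyReduced I y)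
    (hxc : GraphProd.IsConnected I x) (hyc : GraphProd.IsConnected I y)
    (hal : GraphProd.al x = GraphProd.al y) (hcard : 2 ≤ (GraphProd.al x).ncard) :
    IsConj (GraphProd.Word.toGroup I x) (GraphProd.Word.toGroup I y) ↔
      GraphProd.TranspositionEquiv I x y := by
  have hal_x : (GraphProd.al x).Nontrivial :=
    (Set.one_lt_ncard_iff_nontrivial_and_finite.1 hcard).1
  exact mainTheorem7_general (hx.isStrictlyCyclicallyReduced hxc hal_x)
    (hy.isStrictlyCyclicallyReduced hyc (hal ▸ hal_x))
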